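/- Let $X=\{1,2\}$ and let $X^*$ be the set of finite words over $X$. Let $a,b,c,d$ be the permutations of $X^*$ that fix the empty word and satisfy, for all $w\in X^*$, \[ a(1w)=2w,\quad a(2w)=1w,\qquad b(1w)=1\,a(w),\quad b(2w)=2\,c(w), \] \[ c(1w)=1\,a(w),\quad c(2w)=2\,d(w),\qquad d(1w)=1w,\quad d(2w)=2\,b(w). \] The first Grigorchuk group is the group $G_0=\langle a,b,c,d\rangle$ of permutations of $X^*$. For elements $g,h$ of a group put $[g,h]=g^{-1}h^{-1}gh$, $E_0(g,h)=g$ and $E_{n+1}(g,h)=[E_n(g,h),h]$ for $n\ge 0$. Call $(g,h)$ an Engel pair if $E_n(g,h)=1$ for all sufficiently large $n$ (equivalently, for some $n$). An element $h$ of a group $G$ is an Engel element of $G$ if $(g,h)$ is an Engel pair for every $g\in G$, and $G$ is an Engel group if $(g,h)$ is an Engel pair for all $g,h\in G$. **Theorem.** The first Grigorchuk group $G_0$ is not an Engel group. Moreover, an element $h\in G_0$ is an Engel element of $G_0$ if and only if $h^2=1$. -/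

import Mathlib

/-!
The first Grigorchuk group, as a group of permutations of the set `X^*` of finite words over the
two-letter alphabet `X = {1, 2}`, and the Engel conditions in an arbitrary group.
-/

namespace Grigorchuk

/-- The five states of the Grigorchuk automaton; `e` is the identity state. -/
inductive State : Type
  | e | a | b | c | d

/-- The alphabet `{1, 2}`; the letter `1` is `false` and the letter `2` is `true`. -/
abbrev Letter : Type := Bool

/-- Finite words over the alphabet; the first letter of the word is the head of the list. -/
abbrev Word : Type := List Letter

/-- The transition and output map `Φ : X × Q → Q × X` of the Grigorchuk automaton:
`Φ x q = (q', y)` means that the state `q`, reading `x`, writes `y` and moves to the state `q'`. -/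
def Φ : Letter → State → State × Letter
  | false, .a => (.e, true)
  | true, .a => (.e, false)
  | false, .b => (.a, false)
  | true, .b => (.c, true)
  | false, .c => (.a, false)
  | true, .c => (.d, true)
  | false, .d => (.e, false)
  | true, .d => (.b, true)
  | x, .e => (.e, x)

/-- The transformation of words defined by a state of the automaton: the empty word is fixed, and
`x w` is sent to `y w'` where `Φ x q = (q', y)` and `w'` is the image of `w` under `q'`. -/
def act : State → Word → Word
  | _, [] => []
  | q, x :: w => (Φ x q).2 :: act (Φ x q).1 w

/-- Every state of the automaton acts as an involution. -/
theorem act_act (q : State) (w : Word) : act q (act q w) = w := by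
  induction w generalizing q with
  | nil => rfl
  | cons x w ih => cases x <;> cases q <;> simp [act, Φ, ih]

/-- The permutation of the set of words defined by a state of the automaton. -/
def perm (q : State) : Equiv.Perm Word where
  toFun := act q
  invFun := act q
  left_inv := act_act q
  right_inv := act_act q

/-- The first Grigorchuk group `G₀ = ⟨a, b, c, d⟩`. -/
def G₀ : Subgroup (Equiv.Perm Word) :=
  Subgroup.closure {perm .a, perm .b, perm .c, perm .d}

end Grigorchuk

namespace Engel

/-- The iterated commutators `E 0 x y = x` and `E (n + 1) x y = [E n x y, y]`,
where `[u, v] = u⁻¹ v⁻¹ u v`. -/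
def E {G : Type*} [Group G] : ℕ → G → G → G
  | 0, x, _ => x
  | n + 1, x, y => (E n x y)⁻¹ * y⁻¹ * E n x y * y

/-- `(g, h)` is an Engel pair if `E n g h = 1` for all sufficiently large `n`. -/
def IsEngelPair {G : Type*} [Group G] (g h : G) : Prop :=
  ∃ N : ℕ, ∀ n : ℕ, N ≤ n → E n g h = 1

/-- `h` is an Engel element of `G` if `(g, h)` is an Engel pair for all `g` in `G`. -/
def IsEngelElement {G : Type*} [Group G] (h : G) : Prop :=
  ∀ g : G, IsEngelPair g h

/-- `G` is an Engel group if all pairs of its elements are Engel pairs. -/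
def IsEngelGroup (G : Type*) [Group G] : Prop :=
  ∀ g h : G, IsEngelPair g h

end Engel

namespace Grigorchuk

open State

/-! Two facts carry the equivalence. First, `G₀` is a 2-group (`exists_pow_two_pow_eq_one`), by
contraction of a weight under sections. If `h` is an involution, it inverts `x = [g, h]`, so every
further commutator with `h` replaces `x` by `x ^ (-2)`. The iteration stays among powers `x ^ ((-2)
^ n)` and dies because `x` has 2-power order.

Conversely let `h` have order `2 ^ m` with `m ≥ 2`. Some vertex `v` has an `h`-orbit of full length
`2 ^ m`. The subgroup `K` is branching: any element of `K` can be planted below any single vertex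
(`exists_mem_K_at`). Hence any quadruple in `K` can be repeated with period 4 along the orbit by
some `g ∈ G₀` (`exists_actsAlong`), and `[·, h]` then acts on quadruples by `r i ↦ (r i)⁻¹ * r (i +
1)`, the map `cyc`.

It remains to find a quadruple in `K` that no iterate of `cyc` trivializes. Taking sections at a
fixed letter commutes with `cyc`. By alternating the two operations, an explicit quadruple leads
back to itself after a positive number of `cyc` steps (`exists_dominates_self`), so it never dies;
another explicit quadruple, inside `K`, leads to it (`exists_dominates`). -/

theorem apply_inv_apply {α : Type*} (g : Equiv.Perm α) (x : α) : g (g⁻¹ x) = x :=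
  g.apply_symm_apply x

theorem inv_apply_apply {α : Type*} (g : Equiv.Perm α) (x : α) : g⁻¹ (g x) = x :=
  g.symm_apply_apply x

/-! ### Words in the generators -/

/-- The permutation represented by a word in the states. -/
def eval (u : List State) : Equiv.Perm Word := (u.map perm).prod

@[simp] theorem eval_nil : eval [] = 1 := rfl

@[simp] theorem eval_cons (q : State) (u : List State) : eval (q :: u) = perm q * eval u := by
  simp [eval]

@[simp] theorem eval_append (u v : List State) : eval (u ++ v) = eval u * eval v := by
  simp [eval]

theorem perm_apply (q : State) (w : Word) : perm q w = act q w := rfl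

theorem act_e (w : Word) : act e w = w := by
  induction w with
  | nil => rfl
  | cons x w ih => cases x <;> simp [act, Φ, ih]

@[simp] theorem perm_e : perm e = 1 := Equiv.ext act_e

@[simp] theorem perm_mul_self (q : State) : perm q * perm q = 1 := Equiv.ext (act_act q)

@[simp] theorem perm_inv (q : State) : (perm q)⁻¹ = perm q :=
  inv_eq_of_mul_eq_one_left (perm_mul_self q)

theorem eval_reverse (u : List State) : eval u.reverse = (eval u)⁻¹ := by
  induction u with
  | nil => simp
  | cons q u ih => simp [ih]

theorem perm_mem (q : State) : perm q ∈ G₀ := by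
  cases q
  · rw [perm_e]; exact one_mem _
  all_goals exact Subgroup.subset_closure (by simp)

theorem eval_mem (u : List State) : eval u ∈ G₀ := by
  induction u with
  | nil => exact one_mem _
  | cons q u ih => rw [eval_cons]; exact mul_mem (perm_mem q) ih

theorem exists_eval_eq {g : Equiv.Perm Word} (hg : g ∈ G₀) : ∃ u, eval u = g := by
  induction hg using Subgroup.closure_induction with
  | mem x hx =>
    rcases hx with rfl | rfl | rfl | rfl
    exacts [⟨[a], by simp⟩, ⟨[b], by simp⟩, ⟨[c], by simp⟩, ⟨[d], by simp⟩]
  | one => exact ⟨[], rfl⟩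
  | mul x y _ _ hx hy =>
    obtain ⟨u, rfl⟩ := hx
    obtain ⟨v, rfl⟩ := hy
    exact ⟨u ++ v, eval_append u v⟩
  | inv x _ hx =>
    obtain ⟨u, rfl⟩ := hx
    exact ⟨u.reverse, eval_reverse u⟩

/-- The product of states, as long as both lie in `{e, b, c, d}` (and `e` otherwise). -/
def kmul : State → State → State
  | e, y => y
  | x, e => x
  | b, c => d
  | c, b => d
  | b, d => c
  | d, b => c
  | c, d => b
  | d, c => b
  | _, _ => e

theorem act_kmul (w : Word) (x y : State) (hx : x ≠ a) (hy : y ≠ a) :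
    act (kmul x y) w = act x (act y w) := by
  induction w generalizing x y with
  | nil => rfl
  | cons l w ih =>
    cases x <;> cases y <;> simp at hx hy <;> cases l <;>
      simp [act, Φ, kmul, act_e, act_act, ← ih]

theorem perm_kmul {x y : State} (hx : x ≠ a) (hy : y ≠ a) :
    perm (kmul x y) = perm x * perm y :=
  Equiv.ext fun w => act_kmul w x y hx hy

theorem kmul_ne_a {x y : State} (hx : x ≠ a) (hy : y ≠ a) : kmul x y ≠ a := by
  cases x <;> cases y <;> simp_all [kmul]

/-! ### Sections -/

/-- The image of a letter under a word in the states. -/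
def out (x : Letter) : List State → Letter
  | [] => x
  | q :: u => (Φ (out x u) q).2

/-- The section of a word in the states at a letter. -/
def sec (x : Letter) : List State → List State
  | [] => []
  | q :: u => (Φ (out x u) q).1 :: sec x u

theorem eval_apply_nil (u : List State) : eval u [] = [] := by
  induction u with
  | nil => rfl
  | cons q u ih => rw [eval_cons, Equiv.Perm.mul_apply, ih]; cases q <;> rfl

theorem eval_apply_cons (u : List State) (x : Letter) (w : Word) :
    eval u (x :: w) = out x u :: eval (sec x u) w := by
  induction u with
  | nil => rfl
  | cons q u ih => simp [ih, out, sec, perm_apply, act]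

theorem out_append (x : Letter) (u v : List State) : out x (u ++ v) = out (out x v) u := by
  induction u with
  | nil => rfl
  | cons q u ih => simp [out, ih]

theorem sec_append (x : Letter) (u v : List State) :
    sec x (u ++ v) = sec (out x v) u ++ sec x v := by
  induction u with
  | nil => rfl
  | cons q u ih => simp [sec, ih, out_append]

theorem exists_apply_append (u : List State) (v w : Word) :
    ∃ w', w'.length = w.length ∧ eval u (v ++ w) = eval u v ++ w' := by
  induction v generalizing u with
  | nil =>
    refine ⟨eval u w, ?_, by simp [eval_apply_nil]⟩
    induction w generalizing u with
    | nil => simp [eval_apply_nil]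
    | cons x w ih => simp [eval_apply_cons, ih]
  | cons x v ih =>
    obtain ⟨w', h1, h2⟩ := ih (sec x u)
    exact ⟨w', h1, by simp [eval_apply_cons, h2]⟩

theorem length_eval_apply (u : List State) (w : Word) : (eval u w).length = w.length := by
  obtain ⟨w', h1, h2⟩ := exists_apply_append u [] w
  simpa [eval_apply_nil, h1] using congrArg List.length h2

theorem apply_eq_of_apply_append {g : Equiv.Perm Word} (hg : g ∈ G₀) {v w w' : Word}
    (h : g (v ++ w) = v ++ w') : g v = v := by
  obtain ⟨u, rfl⟩ := exists_eval_eq hg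
  obtain ⟨w'', -, h2⟩ := exists_apply_append u v w
  exact (List.append_inj (h2.symm.trans h) (length_eval_apply u v)).1

/-! ### The word problem -/

/-- Prepend a state to a word, cancelling or multiplying it with the first letter if possible. -/
def rcons : State → List State → List State
  | e, v => v
  | q, [] => [q]
  | a, a :: v => v
  | b, b :: v => v
  | c, c :: v => v
  | d, d :: v => v
  | b, c :: v => d :: v
  | c, b :: v => d :: v
  | b, d :: v => c :: v
  | d, b :: v => c :: v
  | c, d :: v => b :: v
  | d, c :: v => b :: v
  | q, v => q :: v

theorem eval_rcons (q : State) (v : List State) : eval (rcons q v) = perm q * eval v := by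
  have key : ∀ {x y z : State}, x ≠ a → y ≠ a → kmul x y = z →
      perm z * eval v.tail = perm x * (perm y * eval v.tail) := by
    rintro x y z hx hy rfl
    rw [perm_kmul hx hy, mul_assoc]
  rcases v with _ | ⟨y, v⟩
  · cases q <;> simp [rcons]
  · cases q <;> cases y <;> first
      | simp [rcons, ← mul_assoc]; done
      | (simp only [rcons, eval_cons]; exact key (by simp) (by simp) rfl)

/-- Free reduction together with multiplication in `{e, b, c, d}`. -/
def reduce : List State → List State
  | [] => []
  | q :: u => rcons q (reduce u)

theorem eval_reduce (u : List State) : eval (reduce u) = eval u := by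
  induction u with
  | nil => rfl
  | cons q u ih => rw [reduce, eval_rcons, ih, eval_cons]

/-- A sufficient criterion, with bounded depth, for a word to represent the identity. -/
def isOne : ℕ → List State → Bool
  | 0, _ => false
  | n + 1, u =>
    match reduce u with
    | [] => true
    | q :: v => !out false (q :: v) && (isOne n (sec false (q :: v)) && isOne n (sec true (q :: v)))

theorem out_true (u : List State) : out true u = !out false u := by
  induction u with
  | nil => rfl
  | cons q u ih => rw [out, out, ih]; cases q <;> cases out false u <;> rfl

theorem eval_eq_one_of_isOne {n : ℕ} {u : List State} (h : isOne n u = true) : eval u = 1 := by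
  induction n generalizing u with
  | zero => simp [isOne] at h
  | succ n ih =>
    rw [isOne] at h
    rw [← eval_reduce]
    split at h
    · next h' => rw [h']; rfl
    · next q v h' =>
      rw [h']
      simp only [Bool.and_eq_true, Bool.not_eq_true'] at h
      ext1 w
      rcases w with _ | ⟨_ | _, w⟩
      · exact eval_apply_nil _
      · simp only [eval_apply_cons, h.1, ih h.2.1, Equiv.Perm.one_apply]
      · simp only [eval_apply_cons, out_true, h.1, ih h.2.2, Equiv.Perm.one_apply, Bool.not_false]

/-! ### The group is a 2-group -/

/-- A weight on the states for which the sections of a product `a x` weigh less in total. -/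
def stateWeight : State → ℕ
  | e => 0
  | a => 3
  | b => 4
  | c => 3
  | d => 2

/-- The total weight of a word in the states. -/
def weight (u : List State) : ℕ := (u.map stateWeight).sum

@[simp] theorem weight_nil : weight [] = 0 := rfl

@[simp] theorem weight_cons (q : State) (u : List State) :
    weight (q :: u) = stateWeight q + weight u := by simp [weight]

@[simp] theorem weight_append (u v : List State) : weight (u ++ v) = weight u + weight v := by
  simp [weight]

/-- The alternating word `a x₁ a x₂ ⋯ a xₙ`. -/
def alt : List State → List State
  | [] => []
  | x :: xs => a :: x :: alt xs

theorem alt_append (xs ys : List State) : alt (xs ++ ys) = alt xs ++ alt ys := by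
  induction xs with
  | nil => rfl
  | cons x xs ih => simp [alt, ih]

/-- The states `b`, `c` and `d`. -/
def IsBCD (x : State) : Prop := x ≠ e ∧ x ≠ a

/-- Each syllable `a x` loses one unit: `a b` weighs 7 and contributes `a, c` of weight 6, `a c`
goes from 6 to `a, d` of weight 5, and `a d` from 5 to `b` of weight 4. -/
theorem weight_sec_alt (xs : List State) (hxs : ∀ x ∈ xs, IsBCD x) :
    weight (sec false (alt xs)) + weight (sec true (alt xs)) + xs.length ≤ weight (alt xs) := by
  induction xs with
  | nil => simp [alt, sec]
  | cons x xs ih =>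
    have h1 := ih fun y hy => hxs y (List.mem_cons_of_mem _ hy)
    have h2 := hxs x List.mem_cons_self
    rcases hf : out false (alt xs) <;> have ht := out_true (alt xs) <;> rw [hf] at ht <;>
      cases x <;> simp [IsBCD] at h2 <;>
      simp [alt, sec, out, hf, ht, Φ, stateWeight] <;> omega

theorem exists_alternating (u : List State) : ∃ (x : State) (xs : List State) (y : State),
    x ≠ a ∧ (∀ z ∈ xs, IsBCD z) ∧ (y = e ∨ y = a) ∧
    eval u = perm x * eval (alt xs) * perm y ∧
    stateWeight x + weight (alt xs) + stateWeight y ≤ weight u := by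
  induction u with
  | nil => exact ⟨e, [], e, by simp, by simp, by simp, by simp [alt], by simp [alt, stateWeight]⟩
  | cons q u ih =>
    obtain ⟨x, xs, y, hx, hxs, hy, he, hw⟩ := ih
    by_cases hq : q = a
    · subst hq
      by_cases hxe : x = e
      · subst hxe
        rcases xs with _ | ⟨z, xs⟩
        · rcases hy with rfl | rfl
          · exact ⟨e, [], a, by simp, by simp, by simp, by simp [alt, he],
              by simp [alt, stateWeight]⟩
          · exact ⟨e, [], e, by simp, by simp, by simp, by simp [alt, he],
              by simp [alt, stateWeight]⟩
        · refine ⟨z, xs, y, (hxs z List.mem_cons_self).2,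
            fun t ht => hxs t (List.mem_cons_of_mem _ ht), hy, ?_, ?_⟩
          · simp [he, alt, ← mul_assoc]
          · simp [alt, stateWeight] at hw ⊢; omega
      · refine ⟨e, x :: xs, y, by simp, ?_, hy, ?_, ?_⟩
        · intro z hz
          rcases List.mem_cons.1 hz with rfl | hz
          exacts [⟨hxe, hx⟩, hxs z hz]
        · simp [he, alt, mul_assoc]
        · simp [alt, stateWeight] at hw ⊢; omega
    · refine ⟨kmul q x, xs, y, kmul_ne_a hq hx, hxs, hy, ?_, ?_⟩
      · simp [he, perm_kmul hq hx, mul_assoc]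
      · have : stateWeight (kmul q x) ≤ stateWeight q + stateWeight x := by
          cases q <;> cases x <;> simp [kmul, stateWeight]
        simp; omega

theorem eval_pow_apply_nil (u : List State) (n : ℕ) : (eval u ^ n) [] = [] := by
  induction n with
  | zero => rfl
  | succ n ih => rw [pow_succ', Equiv.Perm.mul_apply, ih, eval_apply_nil]

theorem eval_pow_apply_cons {u : List State} (hu : ∀ x, out x u = x) (n : ℕ) (x : Letter)
    (w : Word) : (eval u ^ n) (x :: w) = x :: (eval (sec x u) ^ n) w := by
  induction n with
  | zero => rfl
  | succ n ih =>
    rw [pow_succ', Equiv.Perm.mul_apply, ih, eval_apply_cons, hu, pow_succ', Equiv.Perm.mul_apply]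

theorem pow_two_pow_eq_one_of_le {G : Type*} [Monoid G] {g : G} {k l : ℕ} (h : g ^ 2 ^ k = 1)
    (hkl : k ≤ l) : g ^ 2 ^ l = 1 := by
  obtain ⟨m, rfl⟩ := Nat.exists_eq_add_of_le hkl
  rw [pow_add, pow_mul, h, one_pow]

theorem exists_pow_of_sections {u : List State} (hu : ∀ x, out x u = x)
    (h : ∀ x, ∃ k, eval (sec x u) ^ 2 ^ k = 1) : ∃ k, eval u ^ 2 ^ k = 1 := by
  choose k hk using h
  refine ⟨max (k false) (k true), ?_⟩
  ext1 w
  rcases w with _ | ⟨x, w⟩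
  · exact eval_pow_apply_nil _ _
  · rw [eval_pow_apply_cons hu, pow_two_pow_eq_one_of_le (hk x) (by cases x <;> simp)]
    rfl

theorem exists_pow_conj {G : Type*} [Group G] {g : G} (t : G) (h : ∃ k, (t * g * t⁻¹) ^ 2 ^ k = 1) :
    ∃ k, g ^ 2 ^ k = 1 := by
  obtain ⟨k, hk⟩ := h
  refine ⟨k, ?_⟩
  rwa [conj_pow, conj_eq_one_iff] at hk

/-- Induction on the weight. Up to conjugation the word either gets lighter or becomes purely
alternating, and then sections are lighter. -/
theorem exists_eval_pow_eq_one (u : List State) : ∃ k, eval u ^ 2 ^ k = 1 := by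
  induction hn : weight u using Nat.strong_induction_on generalizing u with
  | _ n ih =>
  subst hn
  have main : ∀ xs : List State, (∀ x ∈ xs, IsBCD x) → weight (alt xs) ≤ weight u →
      ∃ k, eval (alt xs) ^ 2 ^ k = 1 := by
    intro xs hxs hw
    rcases eq_or_ne xs [] with rfl | hne
    · exact ⟨0, by simp [alt]⟩
    have hpos := List.length_pos_of_ne_nil hne
    have hs := weight_sec_alt xs hxs
    rcases hf : out false (alt xs) <;> have ht := out_true (alt xs) <;> rw [hf] at ht
    · refine exists_pow_of_sections (fun x => by cases x <;> simp [hf, ht]) fun x => ?_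
      refine ih _ ?_ _ rfl
      cases x <;> omega
    -- The word swaps the two letters, so its square is used: each section of the square is the
    -- product of both sections of the word, still lighter than the word.
    · obtain ⟨k, hk⟩ := exists_pow_of_sections (u := alt xs ++ alt xs)
        (fun x => by cases x <;> simp [out_append, hf, ht]) fun x => by
          refine ih _ ?_ _ rfl
          cases x <;> simp [sec_append, hf, ht] <;> omega
      refine ⟨k + 1, ?_⟩
      rwa [eval_append, ← sq, ← pow_mul, ← pow_succ'] at hk
  obtain ⟨x, xs, y, hx, hxs, rfl | rfl, he, hw⟩ := exists_alternating u
  · by_cases hxe : x = e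
    · subst hxe
      rw [he]
      simpa using main xs hxs (by simp [stateWeight] at hw; omega)
    · rcases List.eq_nil_or_concat xs with rfl | ⟨ys, z, rfl⟩
      · exact ⟨1, by rw [he]; simp [alt, sq]⟩
      · have hz : z ≠ a := (hxs z (by simp)).2
        have hz' : z ≠ e := (hxs z (by simp)).1
        -- Conjugation moves the leading `x` to the end, where it merges with `z` and strictly
        -- lowers the weight.
        refine exists_pow_conj (perm x) ?_
        have : perm x * eval u * (perm x)⁻¹ = eval (alt ys ++ [a, kmul z x]) := by
          rw [he, perm_inv]
          simp [alt_append, alt, perm_kmul hz hx, ← mul_assoc]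
        rw [this]
        refine ih _ ?_ _ rfl
        have : stateWeight (kmul z x) < stateWeight z + stateWeight x := by
          cases z <;> cases x <;> simp_all [kmul, stateWeight]
        have he0 : stateWeight e = 0 := rfl
        simp [alt_append, alt] at hw ⊢
        omega
  · refine exists_pow_conj (perm a) ?_
    have hc : perm a * eval u * (perm a)⁻¹ = perm a * perm x * eval (alt xs) := by
      rw [he, perm_inv]
      simp [mul_assoc]
    rw [hc]
    by_cases hxe : x = e
    · subst hxe
      rcases xs with _ | ⟨z, xs⟩
      · exact ⟨1, by simp [alt, sq]⟩
      · have : perm a * perm e * eval (alt (z :: xs)) = eval (z :: alt xs) := by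
          simp [alt, ← mul_assoc]
        rw [this]
        refine ih _ ?_ _ rfl
        simp [alt, stateWeight] at hw ⊢
        omega
    · have : perm a * perm x * eval (alt xs) = eval (alt (x :: xs)) := by
        simp [alt, mul_assoc]
      rw [this]
      refine main _ ?_ ?_
      · intro z hz
        rcases List.mem_cons.1 hz with rfl | hz
        exacts [⟨hxe, hx⟩, hxs z hz]
      · simp [alt, stateWeight] at hw ⊢; omega

theorem exists_pow_two_pow_eq_one (g : G₀) : ∃ k, g ^ 2 ^ k = 1 := by
  obtain ⟨u, hu⟩ := exists_eval_eq g.2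
  obtain ⟨k, hk⟩ := exists_eval_pow_eq_one u
  exact ⟨k, Subtype.ext (by simpa [hu] using hk)⟩

/-! ### A branching subgroup -/

/-- The permutation acting as `k` below the letter `x` and trivially elsewhere. -/
def lift (x : Letter) : Equiv.Perm Word →* Equiv.Perm Word where
  toFun k :=
    { toFun := fun | [] => [] | y :: w => if y = x then y :: k w else y :: w
      invFun := fun | [] => [] | y :: w => if y = x then y :: k⁻¹ w else y :: w
      left_inv := fun | [] => rfl | y :: w => by by_cases h : y = x <;> simp [h]
      right_inv := fun | [] => rfl | y :: w => by by_cases h : y = x <;> simp [h] }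
  map_one' := by
    ext1 w
    rcases w with _ | ⟨y, w⟩
    · rfl
    · by_cases h : y = x <;> simp [h]
  map_mul' k l := by
    ext1 w
    rcases w with _ | ⟨y, w⟩
    · rfl
    · by_cases h : y = x <;> simp [h]

@[simp] theorem lift_apply_nil (x : Letter) (k : Equiv.Perm Word) : lift x k [] = [] := rfl

theorem lift_apply_cons (x y : Letter) (k : Equiv.Perm Word) (w : Word) :
    lift x k (y :: w) = if y = x then y :: k w else y :: w := rfl

/-- The normal closure of `(ab)²` in `G₀`. -/
def K : Subgroup (Equiv.Perm Word) :=
  Subgroup.closure {k | ∃ g ∈ G₀, k = g * eval [a, b, a, b] * g⁻¹}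

theorem K_le : K ≤ G₀ := by
  refine (Subgroup.closure_le _).2 ?_
  rintro _ ⟨g, hg, rfl⟩
  exact mul_mem (mul_mem hg (eval_mem _)) (inv_mem hg)

theorem conj_mem_K {g k : Equiv.Perm Word} (hg : g ∈ G₀) (hk : k ∈ K) : g * k * g⁻¹ ∈ K := by
  induction hk using Subgroup.closure_induction with
  | mem x hx =>
    obtain ⟨t, ht, rfl⟩ := hx
    refine Subgroup.subset_closure ⟨g * t, mul_mem hg ht, ?_⟩
    group
  | one => simp
  | mul x y _ _ hx hy =>
    rw [← conj_mul]
    exact mul_mem hx hy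
  | inv x _ hx =>
    rw [← conj_inv]
    exact inv_mem hx

theorem eval_eq_of_isOne {n : ℕ} {u v : List State} (h : isOne n (u ++ v.reverse) = true) :
    eval u = eval v := by
  have := eval_eq_one_of_isOne h
  rwa [eval_append, eval_reverse, mul_inv_eq_one] at this

/-- Self-replication: the sections of `aba`, `d`, `b`, `c` at the letter 2 are `a`, `b`, `c`, `d`.
-/
theorem exists_section_eq (u : List State) :
    ∃ v : List State, (∀ x, out x v = x) ∧ eval (sec true v) = eval u := by
  induction u with
  | nil => exact ⟨[], fun _ => rfl, rfl⟩
  | cons q u ih =>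
    obtain ⟨v, hv1, hv2⟩ := ih
    have : ∃ t : List State, (∀ x, out x t = x) ∧ eval (sec true t) = perm q := by
      cases q
      · exact ⟨[], by decide, by simp [sec]⟩
      · exact ⟨[a, b, a], by decide, by simp [sec, out, Φ]⟩
      · exact ⟨[d], by decide, by simp [sec, out, Φ]⟩
      · exact ⟨[b], by decide, by simp [sec, out, Φ]⟩
      · exact ⟨[c], by decide, by simp [sec, out, Φ]⟩
    obtain ⟨t, ht1, ht2⟩ := this
    exact ⟨t ++ v, fun x => by rw [out_append, hv1, ht1],
      by rw [sec_append, hv1, eval_append, eval_cons, ht2, hv2]⟩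

theorem eval_eq_lift {u v : List State} (hu : ∀ x, out x u = x) (hf : eval (sec false u) = 1)
    (ht : eval (sec true u) = eval v) : eval u = lift true (eval v) := by
  ext1 w
  rcases w with _ | ⟨_ | _, w⟩
  · simp [eval_apply_nil]
  · simp [eval_apply_cons, hu, hf, lift_apply_cons]
  · simp [eval_apply_cons, hu, ht, lift_apply_cons]

theorem conj_lift {t : List State} (ht : ∀ x, out x t = x) (k : Equiv.Perm Word) :
    eval t * lift true k * (eval t)⁻¹ =
      lift true (eval (sec true t) * k * (eval (sec true t))⁻¹) := by
  rw [mul_inv_eq_iff_eq_mul]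
  ext1 w
  rcases w with _ | ⟨_ | _, w⟩
  · simp only [Equiv.Perm.mul_apply, eval_apply_nil, lift_apply_nil]
  · simp [-map_mul, -map_inv, eval_apply_cons, ht, lift_apply_cons]
  · simp [-map_mul, -map_inv, eval_apply_cons, ht, lift_apply_cons]

theorem abab_mem_K : eval [a, b, a, b] ∈ K :=
  Subgroup.subset_closure ⟨1, one_mem _, by simp⟩

/-- With pairs of sections, `abab = (ca, ac)` and `d = (1, b)`. Hence `abab · d · (abab)⁻¹ · d` is
`(1, ac·bcab) = (1, abab)`, since `cbc = b`. -/
theorem lift_true_abab_mem : lift true (eval [a, b, a, b]) ∈ K := by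
  have h : eval ([a, b, a, b] ++ ([d] ++ [b, a, b, a] ++ [d])) ∈ K := by
    rw [eval_append]
    refine mul_mem abab_mem_K ?_
    have h1 := conj_mem_K (perm_mem d) (inv_mem abab_mem_K)
    rw [← eval_reverse] at h1
    simpa [mul_assoc] using h1
  have h2 : eval ([a, b, a, b] ++ ([d] ++ [b, a, b, a] ++ [d])) =
      lift true (eval [a, b, a, b]) :=
    eval_eq_lift (by decide) (eval_eq_one_of_isOne (n := 10) (by decide))
      (eval_eq_of_isOne (n := 10) (by decide))
  rwa [h2] at h

/-- Lifting a conjugate of `abab` amounts to conjugating the lifted `abab` by an element with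
prescribed section; conjugation by `a` exchanges the two subtrees. -/
theorem lift_mem_K (x : Letter) {k : Equiv.Perm Word} (hk : k ∈ K) : lift x k ∈ K := by
  have htrue : lift true k ∈ K := by
    induction hk using Subgroup.closure_induction with
    | mem k hk =>
      obtain ⟨g, hg, rfl⟩ := hk
      obtain ⟨u, rfl⟩ := exists_eval_eq hg
      obtain ⟨t, ht1, ht2⟩ := exists_section_eq u
      rw [← ht2, ← conj_lift ht1]
      exact conj_mem_K (eval_mem t) lift_true_abab_mem
    | one => rw [map_one]; exact one_mem _
    | mul x y _ _ hx hy => rw [map_mul]; exact mul_mem hx hy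
    | inv x _ hx => rw [map_inv]; exact inv_mem hx
  cases x
  · convert conj_mem_K (perm_mem a) htrue using 1
    ext1 w
    rcases w with _ | ⟨_ | _, w⟩ <;> simp [lift_apply_cons, perm_apply, act, Φ, act_e]
  · exact htrue

theorem exists_mem_K_at (v : Word) {k : Equiv.Perm Word} (hk : k ∈ K) :
    ∃ g ∈ K, (∀ w, g (v ++ w) = v ++ k w) ∧ ∀ u, (¬ v <+: u) → g u = u := by
  induction v with
  | nil => exact ⟨k, hk, fun w => rfl, fun u hu => absurd u.nil_prefix hu⟩
  | cons x v ih =>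
    obtain ⟨g, hg, h1, h2⟩ := ih
    refine ⟨lift x g, lift_mem_K x hg, fun w => by simp [lift_apply_cons, h1], ?_⟩
    rintro (_ | ⟨y, u⟩) hu
    · rfl
    · by_cases hy : y = x
      · subst hy
        rw [List.cons_prefix_cons] at hu
        simp [lift_apply_cons, h2 u (by simpa using hu)]
      · simp [lift_apply_cons, hy]

/-! ### Iterated commutators along a free orbit -/

/-- The effect of `g ↦ [g, h]` on the sections of `g` along an orbit that `h` permutes freely. -/
def cyc {G : Type*} [Group G] (r : Fin 4 → G) : Fin 4 → G := fun i => (r i)⁻¹ * r (i + 1)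

/-- The permutation `g` acts below the `i`-th vertex of the `h`-orbit of `v` as `r i`, where the
subtrees are identified by means of `h`. -/
def ActsAlong (h : Equiv.Perm Word) (v : Word) (g : Equiv.Perm Word)
    (r : Fin 4 → Equiv.Perm Word) : Prop :=
  ∀ (j : ℕ) (w : Word), g ((h ^ j) (v ++ w)) = (h ^ j) (v ++ r (Fin.ofNat 4 j) w)

theorem ActsAlong.inv_apply {h g : Equiv.Perm Word} {v : Word} {r : Fin 4 → Equiv.Perm Word}
    (H : ActsAlong h v g r) (j : ℕ) (w : Word) :
    g⁻¹ ((h ^ j) (v ++ w)) = (h ^ j) (v ++ (r (Fin.ofNat 4 j))⁻¹ w) := by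
  rw [Equiv.Perm.inv_eq_iff_eq, H, apply_inv_apply]

theorem ActsAlong.commutator {h g : Equiv.Perm Word} {v : Word} {r : Fin 4 → Equiv.Perm Word}
    (H : ActsAlong h v g r) : ActsAlong h v (g⁻¹ * h⁻¹ * g * h) (cyc r) := by
  intro j w
  have h1 : h ((h ^ j) (v ++ w)) = (h ^ (j + 1)) (v ++ w) := by rw [pow_succ']; rfl
  have h2 : Fin.ofNat 4 (j + 1) = Fin.ofNat 4 j + 1 := by
    ext; simp [Fin.val_add]
  rw [Equiv.Perm.mul_apply, Equiv.Perm.mul_apply, Equiv.Perm.mul_apply, h1, H, pow_succ',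
    Equiv.Perm.mul_apply, inv_apply_apply, H.inv_apply, h2]
  rfl

theorem ActsAlong.engel {h g : Equiv.Perm Word} {v : Word} {r : Fin 4 → Equiv.Perm Word}
    (H : ActsAlong h v g r) (n : ℕ) : ActsAlong h v (Engel.E n g h) (cyc^[n] r) := by
  induction n with
  | zero => exact H
  | succ n ih =>
    rw [Function.iterate_succ_apply']
    exact ih.commutator

theorem ActsAlong.eq_one {h : Equiv.Perm Word} {v : Word} {r : Fin 4 → Equiv.Perm Word}
    (H : ActsAlong h v 1 r) : r = 1 := by
  funext i
  ext1 w
  have := H i w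
  rw [Equiv.Perm.one_apply, EmbeddingLike.apply_eq_iff_eq, List.append_cancel_left_eq] at this
  rw [show Fin.ofNat 4 i = i by simp] at this
  exact this.symm

theorem exists_actsAlong {h : Equiv.Perm Word} (hh : h ∈ G₀) {m : ℕ} (hm : 2 ≤ m)
    (h1 : h ^ 2 ^ m = 1) {v : Word} (hv : (h ^ 2 ^ (m - 1)) v ≠ v)
    {r : Fin 4 → Equiv.Perm Word} (hr : ∀ i, r i ∈ K) :
    ∃ g ∈ G₀, ActsAlong h v g r := by
  -- The period of `v` divides `2 ^ m` but not `2 ^ (m - 1)`, so it equals `2 ^ m`.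
  have hper : ∀ k, (h ^ k) v = v → 2 ^ m ∣ k := by
    intro k hk
    have h2 : Function.minimalPeriod h v ∣ 2 ^ m := by
      rw [← Function.isPeriodicPt_iff_minimalPeriod_dvd, Function.IsPeriodicPt,
        Function.IsFixedPt, ← Equiv.Perm.coe_pow, h1, Equiv.Perm.one_apply]
    have h3 : ¬ Function.minimalPeriod h v ∣ 2 ^ (m - 1) := by
      rwa [← Function.isPeriodicPt_iff_minimalPeriod_dvd, Function.IsPeriodicPt,
        Function.IsFixedPt, ← Equiv.Perm.coe_pow]
    have h4 : Function.minimalPeriod h v ∣ k := by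
      rwa [← Function.isPeriodicPt_iff_minimalPeriod_dvd, Function.IsPeriodicPt,
        Function.IsFixedPt, ← Equiv.Perm.coe_pow]
    obtain ⟨l, hl, he⟩ := (Nat.dvd_prime_pow Nat.prime_two).1 h2
    rw [he] at h3 h4
    rw [Nat.pow_dvd_pow_iff_le_right (by norm_num)] at h3
    obtain rfl : l = m := by omega
    exact h4
  choose t ht htv hto using fun i => exists_mem_K_at v (hr i)
  -- The vertices of the orbit are treated one at a time; the factor for the `n`-th vertex is
  -- supported below `h ^ n` applied to `v`.
  have hstep : ∀ n ≤ 2 ^ m, ∃ g ∈ G₀, ∀ j < 2 ^ m, ∀ w,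
      g ((h ^ j) (v ++ w)) =
        if j < n then (h ^ j) (v ++ r (Fin.ofNat 4 j) w) else (h ^ j) (v ++ w) := by
    intro n
    induction n with
    | zero => exact fun _ => ⟨1, one_mem _, fun j _ w => by simp⟩
    | succ n ih =>
      intro hn
      obtain ⟨g, hg, hgj⟩ := ih (by omega)
      refine ⟨g * (h ^ n * t (Fin.ofNat 4 n) * (h ^ n)⁻¹), mul_mem hg (mul_mem (mul_mem
        (pow_mem hh n) (K_le (ht _))) (inv_mem (pow_mem hh n))), fun j hj w => ?_⟩
      rw [Equiv.Perm.mul_apply, Equiv.Perm.mul_apply, Equiv.Perm.mul_apply]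
      rcases eq_or_ne j n with rfl | hne
      · rw [inv_apply_apply, htv, hgj j hj, if_neg (lt_irrefl j),
          if_pos (Nat.lt_succ_self j)]
      · have h2 : ¬ v <+: (h ^ n)⁻¹ ((h ^ j) (v ++ w)) := by
          rintro ⟨w', hw'⟩
          -- A positive exponent makes `hper` applicable: `2 ^ m` divides `2 ^ m - n + j`, which
          -- lies strictly between 0 and `2 * 2 ^ m`, forcing `j = n`.
          have h3 : (h ^ n)⁻¹ = h ^ (2 ^ m - n) := by
            rw [inv_eq_iff_mul_eq_one, ← pow_add, Nat.add_sub_cancel' (by omega), h1]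
          rw [h3, ← Equiv.Perm.mul_apply, ← pow_add] at hw'
          have h4 := hper _ (apply_eq_of_apply_append (pow_mem hh _) hw'.symm)
          obtain ⟨q, hq⟩ := h4
          have : q = 1 := by
            have hq1 : 2 ^ m * q < 2 ^ m * 2 := by omega
            have hq2 : 0 < 2 ^ m * q := by omega
            have := Nat.lt_of_mul_lt_mul_left hq1
            have := Nat.pos_of_mul_pos_left hq2
            omega
          subst this
          omega
        rw [hto _ _ h2, apply_inv_apply, hgj j hj]
        have : j < n ↔ j < n + 1 := by omega
        simp only [this]
  obtain ⟨g, hg, hgj⟩ := hstep (2 ^ m) le_rfl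
  refine ⟨g, hg, fun j w => ?_⟩
  have h2 : h ^ j = h ^ (j % 2 ^ m) := by
    conv_lhs => rw [← Nat.div_add_mod j (2 ^ m), pow_add, pow_mul, h1, one_pow, one_mul]
  -- Here `m ≥ 2` matters: the period 4 of the labels must divide the orbit length.
  have h3 : Fin.ofNat 4 j = Fin.ofNat 4 (j % 2 ^ m) := by
    ext
    simp only [Fin.val_ofNat]
    rw [Nat.mod_mod_of_dvd]
    exact pow_dvd_pow 2 hm
  have h4 : j % 2 ^ m < 2 ^ m := Nat.mod_lt _ (by positivity)
  rw [h2, h3, hgj _ h4, if_pos h4]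

/-! ### A quadruple on which the iteration does not terminate -/

/-- The words representing the image of a quadruple under `cyc`. -/
def cycWords (R : Fin 4 → List State) : Fin 4 → List State :=
  fun i => (R i).reverse ++ R (i + 1)

theorem eval_cycWords (R : Fin 4 → List State) :
    (fun i => eval (cycWords R i)) = cyc fun i => eval (R i) := by
  funext i
  simp [cycWords, cyc, eval_reverse]

theorem eval_iterate_cycWords (n : ℕ) (R : Fin 4 → List State) :
    (fun i => eval (cycWords^[n] R i)) = cyc^[n] fun i => eval (R i) := by
  induction n generalizing R with
  | zero => rfl
  | succ n ih => rw [Function.iterate_succ_apply, ih, eval_cycWords, Function.iterate_succ_apply]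

/-- All entries of `r` fix the letter `x`, with sections the entries of `s`. -/
def HasSections (x : Letter) (r s : Fin 4 → Equiv.Perm Word) : Prop :=
  ∀ i w, r i (x :: w) = x :: s i w

theorem HasSections.cyc {x : Letter} {r s : Fin 4 → Equiv.Perm Word} (H : HasSections x r s) :
    HasSections x (cyc r) (cyc s) := by
  intro i w
  simp only [Grigorchuk.cyc, Equiv.Perm.mul_apply]
  rw [H, Equiv.Perm.inv_eq_iff_eq, H, apply_inv_apply]

theorem HasSections.iterate {x : Letter} {r s : Fin 4 → Equiv.Perm Word}
    (H : HasSections x r s) (n : ℕ) :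
    HasSections x (Grigorchuk.cyc^[n] r) (Grigorchuk.cyc^[n] s) := by
  induction n generalizing r s with
  | zero => exact H
  | succ n ih => exact ih H.cyc

theorem HasSections.eq_one {x : Letter} {s : Fin 4 → Equiv.Perm Word} (H : HasSections x 1 s) :
    s = 1 := by
  funext i
  ext1 w
  simpa using (H i w).symm

theorem cyc_one {G : Type*} [Group G] : cyc (1 : Fin 4 → G) = 1 := by
  funext i; simp [cyc]

theorem iterate_cyc_one {G : Type*} [Group G] (n : ℕ) : cyc^[n] (1 : Fin 4 → G) = 1 :=
  Function.iterate_fixed cyc_one n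

/-- If `cyc` eventually kills `r`, then it kills `s` at least `k` steps earlier. -/
def Dominates (k : ℕ) (r s : Fin 4 → Equiv.Perm Word) : Prop :=
  ∀ n, cyc^[n] r = 1 → cyc^[n - k] s = 1

theorem Dominates.trans {k l : ℕ} {r s t : Fin 4 → Equiv.Perm Word} (h1 : Dominates k r s)
    (h2 : Dominates l s t) : Dominates (k + l) r t := fun n hn => by
  rw [← Nat.sub_sub]; exact h2 _ (h1 n hn)

theorem HasSections.dominates {x : Letter} {k : ℕ} {r s : Fin 4 → Equiv.Perm Word}
    (H : HasSections x (Grigorchuk.cyc^[k] r) s) : Dominates k r s := by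
  intro n hn
  have h1 : Grigorchuk.cyc^[n - k] (Grigorchuk.cyc^[k] r) = 1 := by
    rw [← Function.iterate_add_apply]
    rcases le_total k n with h | h
    · rw [Nat.sub_add_cancel h, hn]
    -- For `n ≤ k` the subtraction truncates to 0, and `cyc^[k] r = 1` still holds because `cyc`
    -- fixes 1.
    · rw [Nat.sub_eq_zero_of_le h, zero_add, ← Nat.sub_add_cancel h, Function.iterate_add_apply,
        hn, iterate_cyc_one]
  have h2 := H.iterate (n - k)
  rw [h1] at h2
  exact h2.eq_one

/-- Infinite descent: a vanishing time `n` would yield the smaller vanishing time `n - k`. -/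
theorem iterate_cyc_ne_one {k : ℕ} (hk : 0 < k) {s : Fin 4 → Equiv.Perm Word} (hs : s ≠ 1)
    (h : Dominates k s s) (n : ℕ) : cyc^[n] s ≠ 1 := by
  induction n using Nat.strong_induction_on with
  | _ n ih =>
    intro hn
    rcases Nat.eq_zero_or_pos n with rfl | hpos
    · exact hs hn
    · exact ih (n - k) (by omega) (h n hn)

/-- The permutations represented by a quadruple of words. -/
def evalQuad (R : Fin 4 → List State) : Fin 4 → Equiv.Perm Word := fun i => eval (R i)

theorem dominates_evalQuad (k : ℕ) (x : Letter) (R S : Fin 4 → List State)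
    (h : (∀ i, out x (cycWords^[k] R i) = x) ∧
      ∀ i, isOne 10 (sec x (cycWords^[k] R i) ++ (S i).reverse) = true) :
    Dominates k (evalQuad R) (evalQuad S) := by
  refine HasSections.dominates (x := x) fun i w => ?_
  have h1 := congrFun (eval_iterate_cycWords k R) i
  rw [show evalQuad R = fun i => eval (R i) from rfl, ← h1, eval_apply_cons, h.1,
    eval_eq_of_isOne (h.2 i)]
  rfl

/-- A closed loop of explicit quadruples; each link applies `cyc` the stated number of times and
then takes sections at the stated letter. The loop uses nine applications in all. -/
theorem exists_dominates_self : ∃ k, 0 < k ∧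
    Dominates k (evalQuad ![[c, a], [a, b], [], [d]]) (evalQuad ![[c, a], [a, b], [], [d]]) := by
  have h1 := dominates_evalQuad 3 false
    ![[c, a], [a, b], [], [d]]
    ![[c, a, c, a], [a, d], [a, d, a, d], [a, d, a, c, a, c]] (by decide)
  have h2 := dominates_evalQuad 2 false
    ![[c, a, c, a], [a, d], [a, d, a, d], [a, d, a, c, a, c]]
    ![[d, a], [c, a], [a, b, a, b, a, d], [d, a, c, a, d, a]] (by decide)
  have h3 := dominates_evalQuad 1 false
    ![[d, a], [c, a], [a, b, a, b, a, d], [d, a, c, a, d, a]]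
    ![[c], [d, a, c], [c, a, b, a, b], [b, a]] (by decide)
  have h4 := dominates_evalQuad 2 false
    ![[c], [d, a, c], [c, a, b, a, b], [b, a]]
    ![[a, b, a, c, a], [a, c, a, b, a, b], [b, a, c], [c, a]] (by decide)
  have h5 := dominates_evalQuad 1 true
    ![[a, b, a, c, a], [a, c, a, b, a, b], [b, a, c], [c, a]]
    ![[a, b, a, c], [b, a, d, a], [d], [a, c, a]] (by decide)
  have h6 := dominates_evalQuad 0 false
    ![[a, b, a, c], [b, a, d, a], [d], [a, c, a]]
    ![[c, a], [a, b], [], [d]] (by decide)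
  exact ⟨_, by norm_num, ((((h1.trans h2).trans h3).trans h4).trans h5).trans h6⟩

/-- The loop quadruple is not in `K`, since `ca` and `ab` swap the letters while `K` fixes them;
this chain enters the loop from a quadruple inside `K`. -/
theorem exists_dominates : ∃ k,
    Dominates k (evalQuad ![[], [], [a, b, a, b], [d, a, b, a, c]])
      (evalQuad ![[c, a], [a, b], [], [d]]) := by
  have h1 := dominates_evalQuad 0 true
    ![[], [], [a, b, a, b], [d, a, b, a, c]]
    ![[], [], [a, c], [b, a, d]] (by decide)
  have h2 := dominates_evalQuad 3 true
    ![[], [], [a, c], [b, a, d]]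
    ![[a, d, a, c], [b, a, d, a, c, a, c], [c, a, c, a, b], [b, a, d]] (by decide)
  have h3 := dominates_evalQuad 2 false
    ![[a, d, a, c], [b, a, d, a, c, a, c], [c, a, c, a, b], [b, a, d]]
    ![[a, b, a, c, a], [a, c, a, b, a, b], [b, a, d, a, b, a], [a, b, a, d, a]] (by decide)
  have h4 := dominates_evalQuad 1 true
    ![[a, b, a, c, a], [a, c, a, b, a, b], [b, a, d, a, b, a], [a, b, a, d, a]]
    ![[a, b, a, c], [b, a, d, a, c, a], [a, b, a, c], [a]] (by decide)
  have h5 := dominates_evalQuad 2 false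
    ![[a, b, a, c], [b, a, d, a, c, a], [a, b, a, c], [a]]
    ![[b, a, d, a, b, a, c, a], [a, c, a, b, a, d, a], [a, b, a], [a, b, a, b]] (by decide)
  have h6 := dominates_evalQuad 0 false
    ![[b, a, d, a, b, a, c, a], [a, c, a, b, a, d, a], [a, b, a], [a, b, a, b]]
    ![[a, b, a, d], [d, a, b], [c], [c, a]] (by decide)
  have h7 := dominates_evalQuad 2 false
    ![[a, b, a, d], [d, a, b], [c], [c, a]]
    ![[a, b, a, d, a], [a, c], [a, c], [c, a, b, a, b, a]] (by decide)
  have h8 := dominates_evalQuad 1 true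
    ![[a, b, a, d, a], [a, c], [a, c], [c, a, b, a, b, a]]
    ![[b], [], [d, a, c, a], [a, c, a, c]] (by decide)
  have h9 := dominates_evalQuad 0 true
    ![[b], [], [d, a, c, a], [a, c, a, c]]
    ![[c], [], [b, a], [a, d]] (by decide)
  have h10 := dominates_evalQuad 3 false
    ![[c], [], [b, a], [a, d]]
    ![[b, a, c], [c, a, b, a, b, a], [a, b, a, c, a], [a, c]] (by decide)
  have h11 := dominates_evalQuad 1 false
    ![[b, a, c], [c, a, b, a, b, a], [a, b, a, c, a], [a, c]]
    ![[a, b, a, c], [b, a, d, a], [d], [a, c, a]] (by decide)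
  have h12 := dominates_evalQuad 0 false
    ![[a, b, a, c], [b, a, d, a], [d], [a, c, a]]
    ![[c, a], [a, b], [], [d]] (by decide)
  exact ⟨_, h1.trans <| h2.trans <| h3.trans <| h4.trans <| h5.trans <| h6.trans <| h7.trans <|
    h8.trans <| h9.trans <| h10.trans <| h11.trans h12⟩

theorem evalQuad_mem_K (i : Fin 4) :
    evalQuad ![[], [], [a, b, a, b], [d, a, b, a, c]] i ∈ K := by
  fin_cases i
  · exact one_mem K
  · exact one_mem K
  · exact abab_mem_K
  · have h := conj_mem_K (perm_mem c) (inv_mem abab_mem_K)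
    have h2 : eval [d, a, b, a, c] = eval ([c] ++ [b, a, b, a] ++ [c]) :=
      eval_eq_of_isOne (n := 10) (by decide)
    change eval [d, a, b, a, c] ∈ K
    rw [h2]
    rw [← eval_reverse] at h
    simpa [mul_assoc] using h

theorem evalQuad_ne_one : evalQuad ![[c, a], [a, b], [], [d]] ≠ 1 := by
  intro h
  have := congrArg (fun g : Equiv.Perm Word => g [false]) (congrFun h 0)
  simp [evalQuad, perm_apply, act, Φ] at this

theorem exists_mem_K_iterate_cyc_ne_one :
    ∃ r : Fin 4 → Equiv.Perm Word, (∀ i, r i ∈ K) ∧ ∀ n, cyc^[n] r ≠ 1 := by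
  refine ⟨_, evalQuad_mem_K, fun n hn => ?_⟩
  obtain ⟨k, hk⟩ := exists_dominates
  obtain ⟨l, hl, h⟩ := exists_dominates_self
  exact iterate_cyc_ne_one hl evalQuad_ne_one h _ (hk n hn)

/-! ### Engel elements -/

theorem coe_engel (n : ℕ) (g h : G₀) :
    ((Engel.E n g h : G₀) : Equiv.Perm Word) = Engel.E n (g : Equiv.Perm Word) h := by
  induction n with
  | zero => rfl
  | succ n ih => simp [Engel.E, ih]

theorem sq_eq_one_of_isEngelElement {h : G₀} (hE : Engel.IsEngelElement h) : h ^ 2 = 1 := by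
  by_contra hne
  have hex := exists_pow_two_pow_eq_one h
  classical
  set m := Nat.find hex
  have hm := Nat.find_spec hex
  have hmin : ∀ k < m, h ^ 2 ^ k ≠ 1 := fun k hk => Nat.find_min hex hk
  have hm2 : 2 ≤ m := by
    by_contra hlt
    exact hne (pow_two_pow_eq_one_of_le (k := m) (l := 1) hm (by omega))
  have h1 : (h : Equiv.Perm Word) ^ 2 ^ m = 1 := by
    simpa using congrArg (Subtype.val) hm
  have h2 : (h : Equiv.Perm Word) ^ 2 ^ (m - 1) ≠ 1 := fun h' =>
    hmin (m - 1) (by omega) (Subtype.ext (by simpa using h'))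
  obtain ⟨v, hv⟩ : ∃ v, ((h : Equiv.Perm Word) ^ 2 ^ (m - 1)) v ≠ v := by
    by_contra! hall
    exact h2 (Equiv.ext hall)
  obtain ⟨r, hr, hr1⟩ := exists_mem_K_iterate_cyc_ne_one
  obtain ⟨g, hg, hgr⟩ := exists_actsAlong h.2 hm2 h1 hv hr
  obtain ⟨N, hN⟩ := hE ⟨g, hg⟩
  have h3 := hgr.engel N
  have h4 := coe_engel N ⟨g, hg⟩ h
  rw [hN N le_rfl] at h4
  rw [← h4] at h3
  exact hr1 N h3.eq_one

end Grigorchuk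

/-! ### Involutions in a 2-group are Engel elements -/

namespace Engel

theorem engel_succ_of_sq_eq_one {G : Type*} [Group G] {g h : G} (hh : h ^ 2 = 1) (n : ℕ) :
    E (n + 1) g h = (E 1 g h) ^ ((-2 : ℤ) ^ n) := by
  have hinv : h⁻¹ = h := inv_eq_of_mul_eq_one_left (by rw [← sq, hh])
  induction n with
  | zero => simp
  | succ n ih =>
    have hconj : h * E 1 g h * h⁻¹ = (E 1 g h)⁻¹ := by
      have hh' : h * h = 1 := by rw [← sq, hh]
      simp [E, hinv, hh', mul_assoc]
    rw [E, ih, mul_assoc, mul_assoc, ← mul_assoc h⁻¹]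
    have : h⁻¹ * E 1 g h ^ ((-2 : ℤ) ^ n) * h = (E 1 g h ^ ((-2 : ℤ) ^ n))⁻¹ := by
      conv_lhs => rw [hinv]
      nth_rewrite 3 [← hinv]
      rw [← conj_zpow, hconj, inv_zpow]
    rw [this, ← zpow_neg, ← zpow_add]
    congr 1
    ring

theorem isEngelElement_of_sq_eq_one {G : Type*} [Group G] (hG : ∀ g : G, ∃ k, g ^ 2 ^ k = 1)
    {h : G} (hh : h ^ 2 = 1) : IsEngelElement h := by
  intro g
  obtain ⟨k, hk⟩ := hG (E 1 g h)
  refine ⟨k + 1, fun n hn => ?_⟩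
  obtain ⟨l, rfl⟩ := Nat.exists_eq_add_of_le' hn
  rw [← add_assoc, engel_succ_of_sq_eq_one hh, pow_add, mul_comm, zpow_mul, neg_pow, mul_comm,
    zpow_mul]
  have : E 1 g h ^ ((2 : ℤ) ^ k) = 1 := by exact_mod_cast hk
  rw [this, one_zpow, one_zpow]

end Engel

theorem theorem1 :
    ¬ Engel.IsEngelGroup Grigorchuk.G₀ ∧
      ∀ h : Grigorchuk.G₀, Engel.IsEngelElement h ↔ h ^ 2 = 1 := by
  refine ⟨fun hG => ?_, fun h => ⟨Grigorchuk.sq_eq_one_of_isEngelElement,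
    Engel.isEngelElement_of_sq_eq_one Grigorchuk.exists_pow_two_pow_eq_one⟩⟩
  -- The element `ab` is not an involution: `(ab)²` has section `ca` at the letter 1, so it moves
  -- the word 11.
  have h1 := Grigorchuk.sq_eq_one_of_isEngelElement
    (h := ⟨_, Grigorchuk.eval_mem [.a, .b]⟩) fun g => hG g _
  have h2 := congrArg (fun g : Grigorchuk.G₀ => (g : Equiv.Perm Grigorchuk.Word) [false, false]) h1
  simp [sq, Grigorchuk.perm_apply, Grigorchuk.act, Grigorchuk.Φ] at h2
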